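/- Let $\alpha\ge 2$ be an integer and $d\ge1$. Pure states on $\mathbb C^{d}\otimes\mathbb C^{d}$ (equal partition $d_A=d_B=d$) are unit vectors $\psi$; the reduced density operator is $\rho_A=\operatorname{tr}_B|\psi\rangle\langle\psi|$ and its Rényi-$\alpha$ entropy is $S_R^{(\alpha)}(\rho_A)=\frac{1}{1-\alpha}\log\operatorname{tr}\rho_A^{\alpha}$, where $\log$ is the logarithm to base $2$. A Borel probability measure $\nu$ on the unit sphere of $\mathbb C^{D}$ is a complex projective $\alpha$-design if $\int p(\psi)\,d\nu(\psi)=\int p(\psi)\,d\psi$ for every polynomial $p$ that is homogeneous of degree $\alpha$ in the coordinates of $\psi$ and homogeneous of degree $\alpha$ in their complex conjugates, $d\psi$ being the normalized uniform measure on the sphere. Let $\mathrm{Cat}_\alpha=\frac{1}{\alpha+1}\binom{2\alpha}{\alpha}$ be the $\alpha$-th Catalan number. (1) For every integer $\alpha\ge2$ there is a function $e_\alpha:\mathbb N\to\mathbb R$ with $e_\alpha(d)=O(d^{-2})$ as $d\to\infty$ such that, for every $d\ge1$ and every complex projective $\alpha$-design $\nu$ on the unit sphere of $\mathbb C^d\otimes\mathbb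 C^d$, the function $\psi\mapsto S_R^{(\alpha)}(\rho_A)$ is $\nu$-integrable and $$\log d-\frac{\log \mathrm{Cat}_\alpha}{\alpha-1}+e_\alpha(d)\ \le\ \mathbb E_{\nu}\,S_R^{(\alpha)}(\rho_A)\ \le\ \log d .$$ (2) There is an absolute constant $K$ such that for every integer $\alpha\ge2$ and all sufficiently large $d$ (depending on $\alpha$), every complex projective $\alpha$-design $\nu$ on the unit sphere of $\mathbb C^d\otimes\mathbb C^d$ satisfies $\mathbb E_{\nu}\,S_R^{(\alpha)}(\rho_A)\ge\log d-K$. That is, the averaged entropy is within $O(1)$ of the maximum $\log d$. -/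

import Mathlib

open MeasureTheory Filter Asymptotics

noncomputable section

namespace QuantumDesign

/-- Pure state vectors of `ℂ^ι`: the unit sphere for the Euclidean (Hilbert space) norm. -/
abbrev PureState (ι : Type) [Fintype ι] : Type :=
  Metric.sphere (0 : EuclideanSpace ℂ ι) 1

/-- The normalized uniform (surface) measure on the complex unit sphere of `ℂ^ι`. -/
def uniformMeasure (ι : Type) [Fintype ι] : Measure (PureState ι) :=
  ((volume : Measure (EuclideanSpace ℂ ι)).toSphere Set.univ)⁻¹ •
    (volume : Measure (EuclideanSpace ℂ ι)).toSphere

/-- A polynomial in the variables `inl i` (standing for the coordinates `ψ i`) and `inr i`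
(standing for their complex conjugates) that is homogeneous of degree `t` in each of the two
groups of variables. -/
def IsBihomogeneous {ι : Type} [Fintype ι] (t : ℕ) (p : MvPolynomial (ι ⊕ ι) ℂ) : Prop :=
  ∀ m ∈ p.support, ∑ i, m (Sum.inl i) = t ∧ ∑ i, m (Sum.inr i) = t

/-- The value of such a polynomial at the vector `ψ`. -/
def evalAt {ι : Type} [Fintype ι] (p : MvPolynomial (ι ⊕ ι) ℂ) (ψ : EuclideanSpace ℂ ι) : ℂ :=
  MvPolynomial.eval (Sum.elim (fun i => ψ i) (fun i => star (ψ i))) p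

/-- `ν` is a complex projective `t`-design: it has the same averages as the uniform measure, for
all polynomials homogeneous of degree `t` both in the coordinates and in their conjugates. -/
def IsProjectiveDesign {ι : Type} [Fintype ι] (t : ℕ) (ν : Measure (PureState ι)) : Prop :=
  ∀ p : MvPolynomial (ι ⊕ ι) ℂ, IsBihomogeneous t p →
    ∫ ψ, evalAt p ψ.1 ∂ν = ∫ ψ, evalAt p ψ.1 ∂(uniformMeasure ι)

/-- The density matrix `|ψ⟩⟨ψ|`. -/
def pureDensity {ι : Type} [Fintype ι] (ψ : EuclideanSpace ℂ ι) : Matrix ι ι ℂ :=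
  Matrix.of fun i j => ψ i * star (ψ j)

/-- The partial trace over the second tensor factor, `ℂ^A ⊗ ℂ^B` being `ℂ^(A × B)`. -/
def partialTraceB {A B : Type} [Fintype B] (M : Matrix (A × B) (A × B) ℂ) : Matrix A A ℂ :=
  Matrix.of fun a a' => ∑ b, M (a, b) (a', b)

/-- The Rényi entropy of integer order `α ≥ 2`, in bits. -/
def renyiEntropy {A : Type} [Fintype A] [DecidableEq A] (α : ℕ) (ρ : Matrix A A ℂ) : ℝ :=
  1 / (1 - (α : ℝ)) * Real.logb 2 ((ρ ^ α).trace).re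

/-- The Rényi entanglement entropy of a bipartite pure state: the Rényi entropy of its reduced
density matrix on the first factor. -/
def entanglementEntropy {A B : Type} [Fintype A] [DecidableEq A] [Fintype B] (α : ℕ)
    (ψ : PureState (A × B)) : ℝ :=
  renyiEntropy α (partialTraceB (pureDensity ψ.1))

end QuantumDesign

end

/-! Up to the factor `1 / (1 - α)` the entropy is the logarithm of `tr ρ ^ α`. Since log is concave,
a lower bound on the mean entropy needs only an upper bound on the mean of `tr ρ ^ α`
(`integral_logb_le`). This trace is bihomogeneous of degree `α`, so a design gives it its uniform
average.

In polar coordinates that average is a Gaussian mean divided by `d² (d² + 1) ⋯ (d² + α - 1)`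
(`integral_uniformMeasure_of_isBihomogeneous`). Integrating one coordinate by parts yields the loop
equation `IsGaussian.map_traceMoment_succ_mul`: a trace either splits in two, which keeps the power
of `d` and reproduces the Catalan recursion, or merges with another trace, which costs `d²`.
Induction on the total degree (`hasPlanarLimit`) gives the mean `Cat_α d ^ (α + 1) (1 + O(d⁻²))`,
hence the first lower bound; `Cat_α ≤ 4 ^ α` makes the loss bounded in `α`.

The upper bound is pointwise: by the power mean inequality for the eigenvalues, `tr ρ ^ α ≥ d ^ (1 -
α)`. -/

noncomputable section

namespace QuantumDesign

/-! ### Loop equations for products of trace moments -/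

section LoopEquations

open MvPolynomial Matrix

/-- Polynomials in the coordinates of a bipartite vector and their conjugates. -/
abbrev CoordPoly (A : Type) : Type := MvPolynomial ((A × A) ⊕ (A × A)) ℂ

/-- The generic matrix of coordinates of a bipartite vector. -/
def coordMatrix (A : Type) : Matrix A A (CoordPoly A) :=
  Matrix.of fun a b => X (Sum.inl (a, b))

/-- The formal adjoint of `coordMatrix`. -/
def conjMatrix (A : Type) : Matrix A A (CoordPoly A) :=
  Matrix.of fun b a => X (Sum.inr (a, b))

/-- The generic reduced (unnormalized) density matrix. -/
def genericReduced (A : Type) [Fintype A] : Matrix A A (CoordPoly A) :=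
  coordMatrix A * conjMatrix A

/-- The `k`-th trace moment of the generic reduced density matrix. -/
def traceMoment (A : Type) [Fintype A] [DecidableEq A] (k : ℕ) : CoordPoly A :=
  (genericReduced A ^ k).trace

/-- A product of trace moments. -/
def momentProd (A : Type) [Fintype A] [DecidableEq A] (l : List ℕ) : CoordPoly A :=
  (l.map (traceMoment A)).prod

lemma map_pderiv_coordMatrix {A : Type} [DecidableEq A] (a b : A) :
    (coordMatrix A).map (pderiv (R := ℂ) (Sum.inr (a, b))) = 0 := by
  ext i j : 1
  simp [coordMatrix, pderiv_X]

lemma map_pderiv_conjMatrix {A : Type} [DecidableEq A] (a b : A) :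
    (conjMatrix A).map (pderiv (R := ℂ) (Sum.inr (a, b))) = Matrix.single b a 1 := by
  ext i j : 1
  by_cases h1 : b = i <;> by_cases h2 : a = j <;> simp [conjMatrix, pderiv_X, h1, h2, eq_comm]

variable {A : Type} [Fintype A]

lemma map_derivation_mul {R : Type*} [CommRing R] [Algebra ℂ R] (D : Derivation ℂ R R)
    (M N : Matrix A A R) : (M * N).map D = M.map D * N + M * N.map D := by
  ext i j
  simp only [Matrix.map_apply, Matrix.mul_apply, Matrix.add_apply, map_sum, Derivation.leibniz,
    smul_eq_mul, ← Finset.sum_add_distrib]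
  exact Finset.sum_congr rfl fun c _ => by ring

variable [DecidableEq A]

@[simp] lemma momentProd_nil : momentProd A [] = 1 := rfl

@[simp] lemma momentProd_cons (k : ℕ) (l : List ℕ) :
    momentProd A (k :: l) = traceMoment A k * momentProd A l := by
  simp [momentProd]

lemma traceMoment_zero : traceMoment A 0 = (Fintype.card A : CoordPoly A) := by
  simp [traceMoment, Matrix.trace_one]

lemma map_pderiv_genericReduced (a b : A) :
    (genericReduced A).map (pderiv (R := ℂ) (Sum.inr (a, b))) =
      coordMatrix A * Matrix.single b a 1 := by
  rw [genericReduced, map_derivation_mul, map_pderiv_coordMatrix, map_pderiv_conjMatrix,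
    Matrix.zero_mul, zero_add]

lemma map_pderiv_genericReduced_pow (a b : A) (m : ℕ) :
    (genericReduced A ^ m).map (pderiv (R := ℂ) (Sum.inr (a, b))) =
      ∑ j ∈ Finset.range m, genericReduced A ^ j * coordMatrix A * Matrix.single b a 1 *
        genericReduced A ^ (m - 1 - j) := by
  induction m with
  | zero =>
    ext i j : 1
    by_cases h : i = j <;> simp [h]
  | succ m ih =>
    have h := map_derivation_mul (pderiv (R := ℂ) (Sum.inr (a, b))) (genericReduced A ^ m)
      (genericReduced A)
    rw [ih, map_pderiv_genericReduced, ← pow_succ] at h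
    rw [h, Finset.sum_range_succ, Finset.sum_mul]
    refine congrArg₂ (· + ·) ?_ ?_
    · refine Finset.sum_congr rfl fun j hj => ?_
      have : m + 1 - 1 - j = (m - 1 - j) + 1 := by
        have := Finset.mem_range.1 hj
        omega
      rw [this, pow_succ, Matrix.mul_assoc _ (genericReduced A ^ (m - 1 - j))]
    · simp [Matrix.mul_assoc]

/-- The Leibniz rule gives `m` terms, one per factor, and cyclicity of the trace makes them equal.
-/
lemma pderiv_traceMoment (a b : A) (m : ℕ) :
    pderiv (R := ℂ) (Sum.inr (a, b)) (traceMoment A m) =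
      m * (genericReduced A ^ (m - 1) * coordMatrix A) a b := by
  have h : pderiv (R := ℂ) (Sum.inr (a, b)) (traceMoment A m) =
      ((genericReduced A ^ m).map (pderiv (R := ℂ) (Sum.inr (a, b)))).trace := by
    simp [traceMoment, Matrix.trace]
  rw [h, map_pderiv_genericReduced_pow, Matrix.trace_sum,
    Finset.sum_congr rfl (g := fun _ => (genericReduced A ^ (m - 1) * coordMatrix A) a b)]
  · simp
  · intro j hj
    have : m - 1 = (m - 1 - j) + j := by
      have := Finset.mem_range.1 hj
      omega
    rw [Matrix.trace_mul_comm, ← Matrix.mul_assoc, ← Matrix.mul_assoc, ← pow_add, ← this,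
      Matrix.trace_mul_comm, Matrix.trace_single_mul]
    simp

/-- The first-order differential operator produced by integrating the first coordinate of
`traceMoment A (k + 1)` by parts. -/
def contraction (k : ℕ) (P : CoordPoly A) : CoordPoly A :=
  ∑ a : A, ∑ b : A, (conjMatrix A * genericReduced A ^ k) b a *
    pderiv (R := ℂ) (Sum.inr (a, b)) P

lemma contraction_one (k : ℕ) : contraction k (1 : CoordPoly A) = 0 := by
  simp [contraction]

lemma contraction_mul (k : ℕ) (P Q : CoordPoly A) :
    contraction k (P * Q) = contraction k P * Q + P * contraction k Q := by
  simp only [contraction, Finset.sum_mul, Finset.mul_sum, ← Finset.sum_add_distrib,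
    Derivation.leibniz, smul_eq_mul]
  refine Finset.sum_congr rfl fun a _ => Finset.sum_congr rfl fun b _ => ?_
  ring

/-- The derivative opens the trace at a conjugate factor, and the coefficient `conjMatrix A *
genericReduced A ^ k` closes it again: two traces merge into one. -/
lemma contraction_traceMoment (k m : ℕ) :
    contraction k (traceMoment A m) = m * traceMoment A (m + k) := by
  rcases m with _ | m
  · simp [contraction, traceMoment_zero]
  have h : genericReduced A ^ (m + 1 + k) =
      genericReduced A ^ m * coordMatrix A * (conjMatrix A * genericReduced A ^ k) := by
    rw [pow_add, pow_succ, genericReduced]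
    simp only [Matrix.mul_assoc]
  simp only [contraction, pderiv_traceMoment]
  rw [traceMoment, h, Matrix.trace, Finset.mul_sum]
  refine Finset.sum_congr rfl fun a _ => ?_
  rw [Matrix.diag_apply, Matrix.mul_apply (M := genericReduced A ^ m * coordMatrix A),
    Finset.mul_sum]
  refine Finset.sum_congr rfl fun b _ => ?_
  simp only [Nat.add_sub_cancel]
  ring

/-- The splitting mechanism: a matrix unit summed over its indices cuts one cyclic product into two.
-/
lemma sum_mul_single_mul (M N : Matrix A A (CoordPoly A)) :
    ∑ a : A, ∑ b : A, (M * Matrix.single b a 1 * N : Matrix A A (CoordPoly A)) b a = M.trace * N.trace := by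
  have h (a b : A) : (M * Matrix.single b a 1 * N : Matrix A A (CoordPoly A)) b a = M b b * N a a := by
    rw [Matrix.mul_assoc, Matrix.mul_apply, Finset.sum_eq_single b]
    · simp
    · intro c _ hc
      simp [hc]
    · simp
  simp only [h, Matrix.trace, Matrix.diag_apply, Finset.sum_mul_sum]
  rw [Finset.sum_comm]

lemma sum_pderiv_conjMatrix_mul_pow (k : ℕ) :
    ∑ a : A, ∑ b : A, pderiv (R := ℂ) (Sum.inr (a, b))
      ((conjMatrix A * genericReduced A ^ k) b a) =
      ∑ i ∈ Finset.range (k + 1), traceMoment A i * traceMoment A (k - i) := by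
  have h (a b : A) : pderiv (R := ℂ) (Sum.inr (a, b))
      ((conjMatrix A * genericReduced A ^ k) b a) =
      (1 * Matrix.single b a 1 * genericReduced A ^ k : Matrix A A (CoordPoly A)) b a +
      ∑ j ∈ Finset.range k, (conjMatrix A * (genericReduced A ^ j * coordMatrix A) *
        Matrix.single b a 1 * genericReduced A ^ (k - 1 - j) :
          Matrix A A (CoordPoly A)) b a := by
    have := congrFun (congrFun (map_derivation_mul (pderiv (R := ℂ) (Sum.inr (a, b)))
      (conjMatrix A) (genericReduced A ^ k)) b) a
    rw [Matrix.map_apply] at this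
    rw [this, map_pderiv_conjMatrix, map_pderiv_genericReduced_pow, Finset.mul_sum,
      Matrix.add_apply, Matrix.sum_apply, Matrix.one_mul]
    simp only [Matrix.mul_assoc]
  simp only [h, Finset.sum_add_distrib]
  -- The term `i = 0` comes from the leading `conjMatrix A`; the `j`-th factor of the power gives `i
  -- = j + 1`.
  rw [sum_mul_single_mul, Finset.sum_range_succ', add_comm]
  refine congrArg₂ (· + ·) ?_ ?_
  · have hc (a : A) : ∑ b : A, ∑ j ∈ Finset.range k,
        (conjMatrix A * (genericReduced A ^ j * coordMatrix A) *
        Matrix.single b a 1 * genericReduced A ^ (k - 1 - j) :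
          Matrix A A (CoordPoly A)) b a =
        ∑ j ∈ Finset.range k, ∑ b : A,
        (conjMatrix A * (genericReduced A ^ j * coordMatrix A) *
        Matrix.single b a 1 * genericReduced A ^ (k - 1 - j) :
          Matrix A A (CoordPoly A)) b a := Finset.sum_comm
    simp only [hc]
    rw [Finset.sum_comm]
    refine Finset.sum_congr rfl fun j _ => ?_
    rw [sum_mul_single_mul, Matrix.trace_mul_comm, Matrix.mul_assoc, ← genericReduced, ← pow_succ,
      traceMoment, traceMoment, Nat.sub_sub, add_comm 1 j]
  · simp [traceMoment]

/-- A linear functional satisfying the integration by parts formula of a standard complex Gaussian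
vector. -/
structure IsGaussian {ι : Type} (φ : MvPolynomial (ι ⊕ ι) ℂ →ₗ[ℂ] ℂ) : Prop where
  map_one : φ 1 = 1
  map_X_mul : ∀ i p, φ (X (Sum.inl i) * p) = φ (pderiv (Sum.inr i) p)

/-- Integration by parts in the first coordinate factor: derivatives falling inside the same trace
split it, those falling on `P` form the contraction. -/
lemma IsGaussian.map_traceMoment_succ_mul {φ : CoordPoly A →ₗ[ℂ] ℂ} (hφ : IsGaussian φ) (k : ℕ)
    (P : CoordPoly A) :
    φ (traceMoment A (k + 1) * P) =
      ∑ i ∈ Finset.range (k + 1), φ (traceMoment A i * (traceMoment A (k - i) * P)) +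
        φ (contraction k P) := by
  have h : traceMoment A (k + 1) = ∑ a : A, ∑ b : A, X (Sum.inl (a, b)) *
      (conjMatrix A * genericReduced A ^ k) b a := by
    have h' : genericReduced A ^ (k + 1) =
        coordMatrix A * (conjMatrix A * genericReduced A ^ k) := by
      rw [pow_succ', ← Matrix.mul_assoc]
      rfl
    rw [traceMoment, h', Matrix.trace]
    refine Finset.sum_congr rfl fun a _ => ?_
    rw [Matrix.diag_apply, Matrix.mul_apply]
    rfl
  simp only [h, Finset.sum_mul, map_sum, mul_assoc, hφ.map_X_mul, Derivation.leibniz, smul_eq_mul,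
    map_add, Finset.sum_add_distrib]
  rw [add_comm]
  congr 1
  · simp only [← mul_assoc, ← map_sum, ← Finset.sum_mul]
    rw [← sum_pderiv_conjMatrix_mul_pow]
    simp only [Finset.sum_mul, mul_comm P]
  · simp only [contraction, map_sum]

end LoopEquations

/-! ### Planar limit with relative error of order `d⁻²` -/

section GenusBound

open MvPolynomial

/-- The terms, with multiplicities, of `contraction k` applied to a product of trace moments. -/
def contractionTerms (k : ℕ) : List ℕ → List (ℕ × List ℕ)
  | [] => []
  | m :: l => (m, (m + k) :: l) :: (contractionTerms k l).map fun x => (x.1, m :: x.2)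

lemma contraction_momentProd {A : Type} [Fintype A] [DecidableEq A] (k : ℕ) (l : List ℕ) :
    contraction k (momentProd A l) =
      ((contractionTerms k l).map fun x => (x.1 : CoordPoly A) * momentProd A x.2).sum := by
  induction l with
  | nil => simp [contractionTerms, contraction_one]
  | cons m l ih =>
    rw [momentProd_cons, contraction_mul, contraction_traceMoment, ih, contractionTerms,
      List.map_cons, List.sum_cons, momentProd_cons, List.map_map, ← List.sum_map_mul_left,
      mul_assoc]
    congr 2
    refine List.map_congr_left fun x _ => ?_
    simp only [Function.comp_apply, momentProd_cons]
    ring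

lemma sum_and_length_of_mem_contractionTerms {k : ℕ} {l : List ℕ} {x : ℕ × List ℕ}
    (hx : x ∈ contractionTerms k l) : x.2.sum = l.sum + k ∧ x.2.length = l.length := by
  induction l generalizing x with
  | nil => simp [contractionTerms] at hx
  | cons m l ih =>
    rw [contractionTerms, List.mem_cons, List.mem_map] at hx
    rcases hx with rfl | ⟨y, hy, rfl⟩
    · simp only [List.sum_cons, List.length_cons, and_true]
      ring
    · obtain ⟨h1, h2⟩ := ih hy
      simp [h1, h2, add_assoc]

/-- The leading coefficient of the Gaussian expectation of a product of trace moments. -/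
def catalanProd (l : List ℕ) : ℕ := (l.map catalan).prod

/-- The exponent of the dimension in the leading term of a product of trace moments. -/
def momentDegree (l : List ℕ) : ℕ := l.sum + l.length

/-- The Gaussian expectation of a product of trace moments agrees with its planar part up to a
relative error of order `d⁻²`. -/
def HasPlanarLimit (l : List ℕ) : Prop :=
  ∃ C : ℝ, 0 ≤ C ∧ ∀ (A : Type) [Fintype A] [DecidableEq A] [Nonempty A]
    (φ : CoordPoly A →ₗ[ℂ] ℂ), IsGaussian φ →
      (Fintype.card A : ℝ) ^ 2 *
        ‖φ (momentProd A l) - catalanProd l * (Fintype.card A : ℂ) ^ momentDegree l‖ ≤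
        C * (Fintype.card A : ℝ) ^ momentDegree l

lemma HasPlanarLimit.norm_le {l : List ℕ} (h : HasPlanarLimit l) :
    ∃ C : ℝ, 0 ≤ C ∧ ∀ (A : Type) [Fintype A] [DecidableEq A] [Nonempty A]
      (φ : CoordPoly A →ₗ[ℂ] ℂ), IsGaussian φ →
        ‖φ (momentProd A l)‖ ≤ C * (Fintype.card A : ℝ) ^ momentDegree l := by
  obtain ⟨C, hC, h⟩ := h
  refine ⟨C + catalanProd l, by positivity, fun A _ _ _ φ hφ => ?_⟩
  have h1 : (1 : ℝ) ≤ Fintype.card A := by exact_mod_cast Fintype.card_pos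
  have h2 := h A φ hφ
  set z := φ (momentProd A l)
  set n := momentDegree l
  set d := (Fintype.card A : ℝ)
  have h3 : ‖z - catalanProd l * (Fintype.card A : ℂ) ^ n‖ ≤ C * d ^ n := by
    refine le_trans ?_ h2
    exact le_mul_of_one_le_left (norm_nonneg _) (one_le_pow₀ h1)
  have h4 : ‖(catalanProd l : ℂ) * (Fintype.card A : ℂ) ^ n‖ = catalanProd l * d ^ n := by
    simp [d]
  calc ‖z‖ = ‖(z - catalanProd l * (Fintype.card A : ℂ) ^ n) +
        catalanProd l * (Fintype.card A : ℂ) ^ n‖ := by simp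
    _ ≤ _ := norm_add_le _ _
    _ ≤ C * d ^ n + catalanProd l * d ^ n := by rw [h4]; gcongr
    _ = _ := by ring

lemma norm_contraction_le (k : ℕ) (l : List ℕ) (n : ℕ)
    (hl : ∀ x ∈ contractionTerms k l, momentDegree x.2 = n ∧ HasPlanarLimit x.2) :
    ∃ C : ℝ, 0 ≤ C ∧ ∀ (A : Type) [Fintype A] [DecidableEq A] [Nonempty A]
      (φ : CoordPoly A →ₗ[ℂ] ℂ), IsGaussian φ →
        ‖φ (contraction k (momentProd A l))‖ ≤ C * (Fintype.card A : ℝ) ^ n := by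
  simp only [contraction_momentProd]
  generalize contractionTerms k l = L at hl
  induction L with
  | nil => exact ⟨0, le_rfl, fun A _ _ _ φ _ => by simp⟩
  | cons x L ih =>
    obtain ⟨C, hC, h⟩ := ih fun y hy => hl y (List.mem_cons_of_mem _ hy)
    obtain ⟨hn, hx⟩ := hl x List.mem_cons_self
    obtain ⟨C', hC', h'⟩ := hx.norm_le
    refine ⟨x.1 * C' + C, by positivity, fun A _ _ _ φ hφ => ?_⟩
    rw [List.map_cons, List.sum_cons, map_add, ← nsmul_eq_mul, map_nsmul, add_mul]
    refine (norm_add_le _ _).trans (add_le_add ?_ (h A φ hφ))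
    rw [nsmul_eq_mul, norm_mul, Complex.norm_natCast, mul_assoc, ← hn]
    exact mul_le_mul_of_nonneg_left (h' A φ hφ) (Nat.cast_nonneg _)

/-- Splitting lowers the sum by one and lengthens the list by one, so `momentDegree` is unchanged;
merging lowers both by one. Only the split terms reach leading order. -/
lemma hasPlanarLimit_cons_succ (k : ℕ) (l : List ℕ)
    (h1 : ∀ i ∈ Finset.range (k + 1), HasPlanarLimit (i :: (k - i) :: l))
    (h2 : ∀ x ∈ contractionTerms k l, HasPlanarLimit x.2) : HasPlanarLimit ((k + 1) :: l) := by
  obtain ⟨C', hC', h'⟩ := norm_contraction_le k l (l.sum + k + l.length) fun x hx => by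
    obtain ⟨ha, hb⟩ := sum_and_length_of_mem_contractionTerms hx
    exact ⟨by rw [momentDegree, ha, hb], h2 x hx⟩
  choose! C hC h using h1
  refine ⟨∑ i ∈ Finset.range (k + 1), C i + C', add_nonneg (Finset.sum_nonneg hC) hC',
    fun A _ _ _ φ hφ => ?_⟩
  set d := (Fintype.card A : ℝ) with hd
  set n := momentDegree ((k + 1) :: l) with hn
  have hn' : n = 2 + (l.sum + k + l.length) := by
    simp only [hn, momentDegree, List.sum_cons, List.length_cons]; ring
  have hdeg (i : ℕ) (hi : i ∈ Finset.range (k + 1)) : momentDegree (i :: (k - i) :: l) = n := by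
    have := Finset.mem_range.1 hi
    simp only [hn, momentDegree, List.sum_cons, List.length_cons]
    omega
  -- The leading coefficients match by the Catalan recursion.
  have hcat : (catalanProd ((k + 1) :: l) : ℂ) =
      ∑ i ∈ Finset.range (k + 1), (catalanProd (i :: (k - i) :: l) : ℂ) := by
    simp only [catalanProd, List.map_cons, List.prod_cons, catalan_succ]
    rw [← Fin.sum_univ_eq_sum_range
      (fun i => ((catalan i * (catalan (k - i) * (l.map catalan).prod) : ℕ) : ℂ))]
    push_cast [Finset.sum_mul]
    exact Finset.sum_congr rfl fun i _ => by ring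
  rw [momentProd_cons, hφ.map_traceMoment_succ_mul, hcat, Finset.sum_mul, add_sub_right_comm,
    ← Finset.sum_sub_distrib, add_mul]
  refine (mul_le_mul_of_nonneg_left (norm_add_le _ _) (by positivity)).trans ?_
  rw [mul_add]
  refine add_le_add ?_ ?_
  · refine (mul_le_mul_of_nonneg_left (norm_sum_le _ _) (by positivity)).trans ?_
    rw [Finset.mul_sum, Finset.sum_mul]
    refine Finset.sum_le_sum fun i hi => ?_
    have := h i hi A φ hφ
    rwa [hdeg i hi, momentProd_cons, momentProd_cons] at this
  · refine (mul_le_mul_of_nonneg_left (h' A φ hφ) (by positivity)).trans (le_of_eq ?_)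
    rw [hn', pow_add]
    ring

lemma hasPlanarLimit_cons_zero {l : List ℕ} (h : HasPlanarLimit l) : HasPlanarLimit (0 :: l) := by
  obtain ⟨C, hC, h⟩ := h
  refine ⟨C, hC, fun A _ _ _ φ hφ => ?_⟩
  have hdeg : momentDegree (0 :: l) = momentDegree l + 1 := by
    simp [momentDegree, add_assoc]
  have hcat : catalanProd (0 :: l) = catalanProd l := by simp [catalanProd]
  rw [momentProd_cons, traceMoment_zero, ← nsmul_eq_mul, map_nsmul, nsmul_eq_mul, hdeg, hcat,
    pow_succ' (Fintype.card A : ℂ), mul_left_comm (catalanProd l : ℂ), ← mul_sub, norm_mul,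
    Complex.norm_natCast, pow_succ' (Fintype.card A : ℝ) (momentDegree l), mul_left_comm,
    mul_left_comm C]
  exact mul_le_mul_of_nonneg_left (h A φ hφ) (Nat.cast_nonneg _)

theorem hasPlanarLimit (l : List ℕ) : HasPlanarLimit l := by
  -- The loop equation lowers the sum; removing a leading zero does not, hence the inner induction
  -- on the list.
  induction hs : l.sum using Nat.strong_induction_on generalizing l with
  | _ s ihs =>
    subst hs
    induction l with
    | nil => exact ⟨0, le_rfl, fun A _ _ _ φ hφ => by
        simp [hφ.map_one, catalanProd, momentDegree]⟩
    | cons k l ih =>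
      rcases k with _ | k
      · exact hasPlanarLimit_cons_zero (ih fun m hm l' hl' => ihs m (by simpa using hm) l' hl')
      · refine hasPlanarLimit_cons_succ k l (fun i hi => ?_) fun x hx => ?_
        · have := Finset.mem_range.1 hi
          refine ihs _ ?_ _ rfl
          simp only [List.sum_cons]
          omega
        · refine ihs _ ?_ _ rfl
          rw [(sum_and_length_of_mem_contractionTerms hx).1, List.sum_cons]
          omega

/-- `contraction 0` is the Euler operator in the conjugate variables. -/
lemma contraction_zero_traceMoment_one_pow {A : Type} [Fintype A] [DecidableEq A] (t : ℕ) :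
    contraction 0 (traceMoment A 1 ^ t) = t * traceMoment A 1 ^ t := by
  induction t with
  | zero => simp [contraction_one]
  | succ t ih =>
    rw [pow_succ, contraction_mul, ih, contraction_traceMoment]
    push_cast
    ring

/-- These are the moments of the squared norm; they supply the normalization between Gaussian and
spherical means. -/
lemma IsGaussian.map_traceMoment_one_pow {A : Type} [Fintype A] [DecidableEq A]
    {φ : CoordPoly A →ₗ[ℂ] ℂ} (hφ : IsGaussian φ) (t : ℕ) :
    φ (traceMoment A 1 ^ t) = ((∏ j ∈ Finset.range t, (Fintype.card A ^ 2 + j) : ℕ) : ℂ) := by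
  induction t with
  | zero => simp [hφ.map_one]
  | succ t ih =>
    have h := hφ.map_traceMoment_succ_mul 0 (traceMoment A 1 ^ t)
    rw [zero_add, Finset.sum_range_one, traceMoment_zero, contraction_zero_traceMoment_one_pow,
      ← pow_succ'] at h
    rw [h, ← nsmul_eq_mul, ← nsmul_eq_mul, ← nsmul_eq_mul, map_nsmul, map_nsmul, map_nsmul, ih,
      Finset.prod_range_succ]
    simp only [nsmul_eq_mul]
    push_cast
    ring

end GenusBound

/-! ### The Gaussian integral and its polar decomposition -/

section GaussianFunctional

open MvPolynomial ComplexConjugate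

/-- The mixed moments of the (unnormalized) Gaussian weight on `ℂ`. -/
def planeMoment (m n : ℕ) : ℂ := ∫ z : ℂ, z ^ m * conj z ^ n * (Real.exp (-‖z‖ ^ 2) : ℂ)

lemma integrable_planeMoment (m n : ℕ) :
    Integrable fun z : ℂ => z ^ m * conj z ^ n * (Real.exp (-‖z‖ ^ 2) : ℂ) := by
  have h : Integrable fun z : ℂ => ‖z‖ ^ ((m + n : ℕ) : ℝ) * Real.exp (-‖z‖ ^ (2 : ℝ)) := by
    -- A non-integrable function has integral `0` by convention, so a positive value proves
    -- integrability.
    have hpos : 0 < ∫ z : ℂ, ‖z‖ ^ ((m + n : ℕ) : ℝ) * Real.exp (-‖z‖ ^ (2 : ℝ)) := by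
      rw [Complex.integral_rpow_mul_exp_neg_rpow one_le_two (by
        have : (0 : ℝ) ≤ ((m + n : ℕ) : ℝ) := Nat.cast_nonneg _
        linarith)]
      have := Real.Gamma_pos_of_pos (s := (((m + n : ℕ) : ℝ) + 2) / 2) (by positivity)
      positivity
    by_contra hc
    rw [integral_undef hc] at hpos
    exact lt_irrefl _ hpos
  refine h.mono' (by fun_prop) (ae_of_all _ fun z => le_of_eq ?_)
  rw [Real.rpow_natCast, Real.rpow_ofNat, norm_mul, norm_mul, norm_pow, norm_pow, RCLike.norm_conj,
    Complex.norm_real, Real.norm_of_nonneg (Real.exp_pos _).le, pow_add]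

lemma planeMoment_self (m : ℕ) : planeMoment m m = Real.pi * (m.factorial : ℂ) := by
  have h := Complex.integral_rpow_mul_exp_neg_rpow (p := 2) (q := ((2 * m : ℕ) : ℝ)) one_le_two
    (by
      have : (0 : ℝ) ≤ ((2 * m : ℕ) : ℝ) := Nat.cast_nonneg _
      linarith)
  have hg : (((2 * m : ℕ) : ℝ) + 2) / 2 = m + 1 := by push_cast; ring
  rw [hg, Real.Gamma_nat_eq_factorial] at h
  have h' : planeMoment m m =
      ((∫ z : ℂ, ‖z‖ ^ ((2 * m : ℕ) : ℝ) * Real.exp (-‖z‖ ^ (2 : ℝ)) : ℝ) : ℂ) := by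
    rw [planeMoment, ← integral_complex_ofReal]
    refine integral_congr_ae (ae_of_all _ fun z => ?_)
    simp only [Real.rpow_natCast, Real.rpow_ofNat]
    rw [← mul_pow, Complex.mul_conj, Complex.normSq_eq_norm_sq]
    push_cast
    rw [pow_mul]
  rw [h', h]
  push_cast
  ring

/-- Rotation by one radian multiplies the integral by `exp (i (m - n))`, which is not `1` because
`π` is irrational. -/
lemma planeMoment_of_ne {m n : ℕ} (h : m ≠ n) : planeMoment m n = 0 := by
  obtain ⟨c, hne⟩ : ∃ c : Circle, (c : ℂ) ^ m * conj (c : ℂ) ^ n ≠ 1 := by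
    refine ⟨Circle.exp 1, fun hE => ?_⟩
    have h1 : Circle.exp ((m : ℝ) - n) = 1 := by
      rw [Circle.ext_iff, Circle.coe_exp, Circle.coe_one, ← hE, Circle.coe_exp,
        ← Complex.exp_conj, ← Complex.exp_nat_mul, ← Complex.exp_nat_mul, ← Complex.exp_add]
      congr 1
      simp
      ring
    rw [Circle.exp_eq_one] at h1
    obtain ⟨k, hk⟩ := h1
    rcases eq_or_ne k 0 with rfl | hk0
    · apply h
      have : (m : ℝ) = n := by simpa [sub_eq_zero] using hk
      exact_mod_cast this
    · have hirr := irrational_pi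
      apply hirr
      refine ⟨((m : ℚ) - n) / (2 * k), ?_⟩
      have : (k : ℝ) ≠ 0 := by exact_mod_cast hk0
      push_cast
      rw [hk]
      field_simp
  have hmp : MeasurePreserving (rotation c) (volume : Measure ℂ) volume :=
    (rotation c).measurePreserving
  have hi : planeMoment m n = (c : ℂ) ^ m * conj (c : ℂ) ^ n * planeMoment m n := by
    conv_lhs => rw [planeMoment,
      ← hmp.integral_comp (rotation c).toHomeomorph.measurableEmbedding]
    rw [planeMoment, ← integral_const_mul]
    refine integral_congr_ae (ae_of_all _ fun z => ?_)
    simp only [rotation_apply, map_mul, mul_pow, norm_mul, Circle.norm_coe, one_mul]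
    ring
  have : (1 - (c : ℂ) ^ m * conj (c : ℂ) ^ n) * planeMoment m n = 0 := by
    linear_combination hi
  exact (mul_eq_zero.1 this).resolve_left (sub_ne_zero.2 hne.symm)

lemma planeMoment_succ (m n : ℕ) : planeMoment (m + 1) n = n * planeMoment m (n - 1) := by
  rcases n with _ | n
  · simp [planeMoment_of_ne (Nat.succ_ne_zero m)]
  · rcases eq_or_ne m n with rfl | h
    · rw [Nat.add_sub_cancel, planeMoment_self, planeMoment_self, Nat.factorial_succ]
      push_cast
      ring
    · rw [Nat.add_sub_cancel, planeMoment_of_ne h, planeMoment_of_ne (by omega), mul_zero]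

variable {ι : Type} [Fintype ι]

lemma evalAt_monomial (s : (ι ⊕ ι) →₀ ℕ) (a : ℂ) (ψ : EuclideanSpace ℂ ι) :
    evalAt (monomial s a) ψ =
      a * ∏ i, (ψ i ^ s (Sum.inl i) * conj (ψ i) ^ s (Sum.inr i)) := by
  rw [evalAt, eval_monomial, Finsupp.prod_fintype _ _ (by simp), Fintype.prod_sum_type,
    Finset.prod_mul_distrib]
  rfl

lemma exp_neg_norm_sq (ψ : EuclideanSpace ℂ ι) :
    (Real.exp (-‖ψ‖ ^ 2) : ℂ) = ∏ i, (Real.exp (-‖ψ i‖ ^ 2) : ℂ) := by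
  rw [EuclideanSpace.norm_sq_eq, ← Finset.sum_neg_distrib, Real.exp_sum, Complex.ofReal_prod]

lemma measurableEmbedding_ofLp :
    MeasurableEmbedding (WithLp.ofLp : EuclideanSpace ℂ ι → ι → ℂ) :=
  (PiLp.continuousLinearEquiv 2 ℝ (fun _ : ι => ℂ)).toHomeomorph.measurableEmbedding

/-- Uniqueness of Haar measure; the constant need not be known, as it cancels in `gaussianMean`. -/
lemma exists_map_ofLp_volume (ι : Type) [Fintype ι] : ∃ c : NNReal, c ≠ 0 ∧
    (volume : Measure (EuclideanSpace ℂ ι)).map WithLp.ofLp =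
      c • (volume : Measure (ι → ℂ)) := by
  let L : EuclideanSpace ℂ ι ≃L[ℝ] (ι → ℂ) := PiLp.continuousLinearEquiv 2 ℝ (fun _ : ι => ℂ)
  have : (Measure.map WithLp.ofLp (volume : Measure (EuclideanSpace ℂ ι))).IsAddHaarMeasure :=
    L.isAddHaarMeasure_map _
  refine ⟨(Measure.map WithLp.ofLp (volume : Measure (EuclideanSpace ℂ ι))).addHaarScalarFactor
    (volume : Measure (ι → ℂ)), ?_, ?_⟩
  · exact (Measure.addHaarScalarFactor_pos_of_isAddHaarMeasure _ _).ne'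
  · exact Measure.isAddLeftInvariant_eq_smul _ _

lemma evalAt_monomial_mul_exp (s : (ι ⊕ ι) →₀ ℕ) (a : ℂ) (ψ : EuclideanSpace ℂ ι) :
    evalAt (monomial s a) ψ * (Real.exp (-‖ψ‖ ^ 2) : ℂ) =
      a * ∏ i, (ψ i ^ s (Sum.inl i) * conj (ψ i) ^ s (Sum.inr i) *
        (Real.exp (-‖ψ i‖ ^ 2) : ℂ)) := by
  rw [evalAt_monomial, exp_neg_norm_sq, mul_assoc, ← Finset.prod_mul_distrib]

lemma integrable_evalAt_mul_exp (p : MvPolynomial (ι ⊕ ι) ℂ) :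
    Integrable fun ψ : EuclideanSpace ℂ ι => evalAt p ψ * (Real.exp (-‖ψ‖ ^ 2) : ℂ) := by
  induction p using MvPolynomial.induction_on' with
  | monomial s a =>
    simp only [evalAt_monomial_mul_exp]
    refine Integrable.const_mul ?_ a
    obtain ⟨c, -, hc⟩ := exists_map_ofLp_volume ι
    have h : Integrable (fun x : ι → ℂ => ∏ i, (x i ^ s (Sum.inl i) * conj (x i) ^ s (Sum.inr i) *
        (Real.exp (-‖x i‖ ^ 2) : ℂ))) (volume : Measure (ι → ℂ)) :=
      Integrable.fintype_prod (f := fun i z => z ^ s (Sum.inl i) * conj z ^ s (Sum.inr i) *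
        (Real.exp (-‖z‖ ^ 2) : ℂ)) fun i => integrable_planeMoment _ _
    have h' := h.smul_measure_nnreal (c := c)
    rw [← hc, measurableEmbedding_ofLp.integrable_map_iff] at h'
    exact h'
  | add p q hp hq =>
    simp only [evalAt, map_add, add_mul] at hp hq ⊢
    exact hp.add hq

/-- Integration of a polynomial against the unnormalized Gaussian weight. -/
def gaussianIntegral (ι : Type) [Fintype ι] : MvPolynomial (ι ⊕ ι) ℂ →ₗ[ℂ] ℂ where
  toFun p := ∫ ψ : EuclideanSpace ℂ ι, evalAt p ψ * (Real.exp (-‖ψ‖ ^ 2) : ℂ)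
  map_add' p q := by
    rw [← integral_add (integrable_evalAt_mul_exp p) (integrable_evalAt_mul_exp q)]
    simp only [evalAt, map_add, add_mul]
  map_smul' c p := by
    rw [RingHom.id_apply, smul_eq_mul, ← integral_const_mul]
    simp only [evalAt, smul_eval, mul_assoc]

lemma exists_gaussianIntegral_monomial (ι : Type) [Fintype ι] : ∃ c : ℂ, c ≠ 0 ∧
    ∀ (s : (ι ⊕ ι) →₀ ℕ) (a : ℂ), gaussianIntegral ι (monomial s a) =
      c * (a * ∏ i, planeMoment (s (Sum.inl i)) (s (Sum.inr i))) := by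
  obtain ⟨c, hc0, hc⟩ := exists_map_ofLp_volume ι
  refine ⟨((c : ℝ) : ℂ), by exact_mod_cast hc0, fun s a => ?_⟩
  have h := measurableEmbedding_ofLp.integral_map (μ := (volume : Measure (EuclideanSpace ℂ ι)))
    fun x : ι → ℂ => a * ∏ i, (x i ^ s (Sum.inl i) * conj (x i) ^ s (Sum.inr i) *
        (Real.exp (-‖x i‖ ^ 2) : ℂ))
  rw [hc, integral_smul_nnreal_measure, integral_const_mul, integral_fintype_prod_volume_eq_prod
    (f := fun i z => z ^ s (Sum.inl i) * conj z ^ s (Sum.inr i) *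
        (Real.exp (-‖z‖ ^ 2) : ℂ))] at h
  change ∫ ψ : EuclideanSpace ℂ ι, evalAt (monomial s a) ψ * (Real.exp (-‖ψ‖ ^ 2) : ℂ) = _
  simp only [evalAt_monomial_mul_exp]
  rw [← h]
  rfl

/-- Integration by parts on monomials: only the `i`-th factor changes. When `s (Sum.inr i) = 0` the
subtraction truncates, but the prefactor vanishes. -/
lemma prod_planeMoment_add_single [DecidableEq ι] (s : (ι ⊕ ι) →₀ ℕ) (i : ι) :
    ∏ j, planeMoment ((Finsupp.single (Sum.inl i) 1 + s : (ι ⊕ ι) →₀ ℕ) (Sum.inl j))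
        ((Finsupp.single (Sum.inl i) 1 + s : (ι ⊕ ι) →₀ ℕ) (Sum.inr j)) =
      s (Sum.inr i) * ∏ j, planeMoment ((s - Finsupp.single (Sum.inr i) 1 : (ι ⊕ ι) →₀ ℕ) (Sum.inl j))
        ((s - Finsupp.single (Sum.inr i) 1 : (ι ⊕ ι) →₀ ℕ) (Sum.inr j)) := by
  rw [← Finset.mul_prod_erase _ _ (Finset.mem_univ i),
    ← Finset.mul_prod_erase (a := i) _ (fun j => planeMoment
      ((s - Finsupp.single (Sum.inr i) 1 : (ι ⊕ ι) →₀ ℕ) (Sum.inl j))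
        ((s - Finsupp.single (Sum.inr i) 1 : (ι ⊕ ι) →₀ ℕ) (Sum.inr j))) (Finset.mem_univ i), ← mul_assoc]
  congr 1
  · simp [add_comm 1, planeMoment_succ]
  · refine Finset.prod_congr rfl fun j hj => ?_
    have hj' : i ≠ j := (Finset.ne_of_mem_erase hj).symm
    simp [hj']

lemma gaussianIntegral_one_ne_zero (ι : Type) [Fintype ι] : gaussianIntegral ι 1 ≠ 0 := by
  obtain ⟨c, hc0, hc⟩ := exists_gaussianIntegral_monomial ι
  have := hc 0 1
  rw [monomial_zero', C_1] at this
  rw [this]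
  simp [hc0, planeMoment_self, Real.pi_ne_zero]

/-- The expectation of a polynomial in a standard complex Gaussian vector and its conjugate. -/
def gaussianMean (ι : Type) [Fintype ι] : MvPolynomial (ι ⊕ ι) ℂ →ₗ[ℂ] ℂ :=
  (gaussianIntegral ι 1)⁻¹ • gaussianIntegral ι

lemma isGaussian_gaussianMean (ι : Type) [Fintype ι] : IsGaussian (gaussianMean ι) where
  map_one := by simp [gaussianMean, gaussianIntegral_one_ne_zero]
  map_X_mul i p := by
    classical
    rw [gaussianMean, LinearMap.smul_apply, LinearMap.smul_apply]
    congr 1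
    obtain ⟨c, -, hc⟩ := exists_gaussianIntegral_monomial ι
    induction p using MvPolynomial.induction_on' with
    | monomial s a =>
      rw [pderiv_monomial, X, monomial_mul, one_mul, hc, hc, prod_planeMoment_add_single]
      ring
    | add p q hp hq => rw [mul_add, map_add, map_add, map_add, hp, hq]

lemma evalAt_smul_of_isBihomogeneous {t : ℕ} {p : MvPolynomial (ι ⊕ ι) ℂ}
    (hp : IsBihomogeneous t p) (r : ℝ) (ψ : EuclideanSpace ℂ ι) :
    evalAt p (r • ψ) = (r : ℂ) ^ (2 * t) * evalAt p ψ := by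
  simp only [evalAt, eval_eq', Finset.mul_sum]
  refine Finset.sum_congr rfl fun m hm => ?_
  obtain ⟨h1, h2⟩ := hp m hm
  simp only [Fintype.prod_sum_type, Sum.elim_inl, Sum.elim_inr, PiLp.smul_apply,
    Complex.real_smul, star_mul', mul_pow, Finset.prod_mul_distrib, Finset.prod_pow_eq_pow_sum,
    h1, h2]
  have : star (r : ℂ) = r := Complex.conj_ofReal r
  rw [this]
  ring

/-- In polar coordinates the integrand factors; `R` is the radial integral and depends on `p` only
through its degree. -/
lemma exists_gaussianIntegral_eq_toSphere (ι : Type) [Fintype ι] [Nonempty ι] (t : ℕ) :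
    ∃ R : ℂ, ∀ p : MvPolynomial (ι ⊕ ι) ℂ, IsBihomogeneous t p →
      gaussianIntegral ι p = R * ∫ ψ : PureState ι, evalAt p ψ.1
        ∂(volume : Measure (EuclideanSpace ℂ ι)).toSphere := by
  refine ⟨∫ r : Set.Ioi (0 : ℝ), ((r : ℝ) : ℂ) ^ (2 * t) * (Real.exp (-(r : ℝ) ^ 2) : ℂ)
    ∂(Measure.volumeIoiPow (Module.finrank ℝ (EuclideanSpace ℂ ι) - 1)), fun p hp => ?_⟩
  set f : EuclideanSpace ℂ ι → ℂ := fun ψ => evalAt p ψ * (Real.exp (-‖ψ‖ ^ 2) : ℂ) with hf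
  calc gaussianIntegral ι p = ∫ ψ, f ψ := rfl
    _ = ∫ ψ : ({(0)}ᶜ : Set (EuclideanSpace ℂ ι)), f ψ
        ∂((volume : Measure (EuclideanSpace ℂ ι)).comap (↑)) := by
      rw [integral_subtype_comap (measurableSet_singleton _).compl f, restrict_compl_singleton]
    _ = ∫ x : PureState ι × Set.Ioi (0 : ℝ), f ((x.2 : ℝ) • (x.1 : EuclideanSpace ℂ ι))
        ∂((volume : Measure (EuclideanSpace ℂ ι)).toSphere.prod
          (Measure.volumeIoiPow (Module.finrank ℝ (EuclideanSpace ℂ ι) - 1))) := by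
      rw [← (volume : Measure (EuclideanSpace ℂ ι)).measurePreserving_homeomorphUnitSphereProd
        |>.integral_comp (Homeomorph.measurableEmbedding _)]
      refine integral_congr_ae (ae_of_all _ fun x => ?_)
      have hx : ‖(x : EuclideanSpace ℂ ι)‖ ≠ 0 := norm_ne_zero_iff.2 x.2
      simp [smul_smul, hx]
    _ = ∫ x : PureState ι × Set.Ioi (0 : ℝ), evalAt p x.1.1 *
        (((x.2 : ℝ) : ℂ) ^ (2 * t) * (Real.exp (-(x.2 : ℝ) ^ 2) : ℂ))
        ∂((volume : Measure (EuclideanSpace ℂ ι)).toSphere.prod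
          (Measure.volumeIoiPow (Module.finrank ℝ (EuclideanSpace ℂ ι) - 1))) := by
      refine integral_congr_ae (ae_of_all _ fun x => ?_)
      have hx : ‖(x.1 : EuclideanSpace ℂ ι)‖ = 1 := by simp
      simp only [hf, evalAt_smul_of_isBihomogeneous hp, norm_smul, hx, mul_one, Real.norm_eq_abs,
        sq_abs]
      ring
    _ = _ := by
      rw [integral_prod_mul (fun ψ : PureState ι => evalAt p ψ.1)
        (fun r : Set.Ioi (0 : ℝ) => ((r : ℝ) : ℂ) ^ (2 * t) * (Real.exp (-(r : ℝ) ^ 2) : ℂ)),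
        mul_comm]

end GaussianFunctional

/-! ### From Gaussian means to uniform averages on the sphere -/

section SphereAverages

open MvPolynomial ComplexConjugate

/-- The bidegree of a variable. -/
def bidegree {ι : Type} : ι ⊕ ι → ℕ × ℕ := Sum.elim (fun _ => (1, 0)) fun _ => (0, 1)

lemma isBihomogeneous_of_isWeightedHomogeneous {ι : Type} [Fintype ι] {t : ℕ}
    {p : MvPolynomial (ι ⊕ ι) ℂ} (hp : IsWeightedHomogeneous bidegree p (t, t)) :
    IsBihomogeneous t p := by
  intro m hm
  have h := hp (mem_support_iff.1 hm)
  rw [Finsupp.weight_apply, Finsupp.sum_fintype _ _ (by simp), Fintype.sum_sum_type,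
    Prod.ext_iff] at h
  simpa [bidegree, Prod.fst_sum, Prod.snd_sum] using h

variable {A : Type} [Fintype A] [DecidableEq A]

lemma isWeightedHomogeneous_genericReduced_pow (k : ℕ) (a b : A) :
    IsWeightedHomogeneous bidegree ((genericReduced A ^ k) a b) (k, k) := by
  induction k generalizing b with
  | zero =>
    by_cases h : a = b
    · rw [pow_zero, h, Matrix.one_apply_eq]
      exact isWeightedHomogeneous_one ℂ bidegree
    · simpa [h] using isWeightedHomogeneous_zero ℂ (bidegree (ι := A × A)) _
  | succ k ih =>
    rw [pow_succ, Matrix.mul_apply]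
    refine IsWeightedHomogeneous.sum _ _ _ fun c _ => (ih c).mul (n := (1, 1)) ?_
    rw [genericReduced, Matrix.mul_apply]
    exact IsWeightedHomogeneous.sum _ _ _ fun e _ =>
      (isWeightedHomogeneous_X ℂ bidegree (Sum.inl (c, e))).mul
        (isWeightedHomogeneous_X ℂ bidegree (Sum.inr (b, e)))

lemma isWeightedHomogeneous_traceMoment (k : ℕ) :
    IsWeightedHomogeneous bidegree (traceMoment A k) (k, k) :=
  IsWeightedHomogeneous.sum _ _ _ fun a _ => isWeightedHomogeneous_genericReduced_pow k a a

lemma isBihomogeneous_traceMoment (k : ℕ) : IsBihomogeneous k (traceMoment A k) :=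
  isBihomogeneous_of_isWeightedHomogeneous (isWeightedHomogeneous_traceMoment k)

lemma isBihomogeneous_traceMoment_one_pow (t : ℕ) : IsBihomogeneous t (traceMoment A 1 ^ t) := by
  apply isBihomogeneous_of_isWeightedHomogeneous
  simpa using (isWeightedHomogeneous_traceMoment (A := A) 1).pow t

lemma evalAt_traceMoment (k : ℕ) (ψ : EuclideanSpace ℂ (A × A)) :
    evalAt (traceMoment A k) ψ = (partialTraceB (pureDensity ψ) ^ k).trace := by
  set ev := eval (Sum.elim (fun i => ψ i) fun i => star (ψ i)) with hev
  have h : ev.mapMatrix (genericReduced A) = partialTraceB (pureDensity ψ) := by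
    ext a b
    simp [genericReduced, Matrix.mul_apply, coordMatrix, conjMatrix, partialTraceB, pureDensity,
      hev]
  rw [← h, ← map_pow]
  simp [evalAt, traceMoment, Matrix.trace, hev]

lemma trace_partialTraceB {A : Type} [Fintype A] (ψ : PureState (A × A)) :
    (partialTraceB (pureDensity ψ.1)).trace = 1 := by
  have h : ‖ψ.1‖ ^ 2 = 1 := by simp
  rw [EuclideanSpace.norm_sq_eq, Fintype.sum_prod_type] at h
  have h' : ∀ z : ℂ, z * star z = ((‖z‖ ^ 2 : ℝ) : ℂ) := fun z => by
    rw [← Complex.normSq_eq_norm_sq]; exact Complex.mul_conj z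
  simp only [Matrix.trace, Matrix.diag_apply, partialTraceB, Matrix.of_apply, pureDensity, h']
  exact_mod_cast h

lemma evalAt_traceMoment_one_pow (t : ℕ) (ψ : PureState (A × A)) :
    evalAt (traceMoment A 1 ^ t) ψ.1 = 1 := by
  have h := evalAt_traceMoment 1 ψ.1
  rw [pow_one, trace_partialTraceB] at h
  rw [evalAt, map_pow]
  rw [evalAt] at h
  rw [h, one_pow]

theorem integral_uniformMeasure_of_isBihomogeneous [Nonempty A] {t : ℕ} {p : CoordPoly A}
    (hp : IsBihomogeneous t p) :
    ∫ ψ, evalAt p ψ.1 ∂(uniformMeasure (A × A)) =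
      gaussianMean (A × A) p /
        ((∏ j ∈ Finset.range t, (Fintype.card A ^ 2 + j) : ℕ) : ℂ) := by
  obtain ⟨R, hR⟩ := exists_gaussianIntegral_eq_toSphere (A × A) t
  -- `traceMoment A 1 ^ t` is `1` on the sphere and has known Gaussian mean, which determines `R`
  -- without computing it.
  have hN := hR _ (isBihomogeneous_traceMoment_one_pow t)
  have hp' := hR p hp
  have hmean := (isGaussian_gaussianMean (A × A)).map_traceMoment_one_pow t
  set Q : ℕ := ∏ j ∈ Finset.range t, (Fintype.card A ^ 2 + j) with hQ
  have hQ0 : (Q : ℂ) ≠ 0 := by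
    have : 0 < Q := Finset.prod_pos fun j _ => by
      have := Fintype.card_pos (α := A)
      positivity
    exact_mod_cast this.ne'
  have h1 := gaussianIntegral_one_ne_zero (A × A)
  set S := (volume : Measure (EuclideanSpace ℂ (A × A))).toSphere with hS
  simp only [evalAt_traceMoment_one_pow, integral_const, Complex.real_smul, mul_one] at hN
  simp only [gaussianMean, LinearMap.smul_apply, smul_eq_mul] at hmean ⊢
  rw [hN] at hmean
  have hRS : R * (S.real Set.univ : ℂ) = Q * gaussianIntegral (A × A) 1 := by
    rw [← hmean]
    field_simp
  have hRS0 : R * (S.real Set.univ : ℂ) ≠ 0 := by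
    rw [hRS]
    exact mul_ne_zero hQ0 h1
  have hR0 := left_ne_zero_of_mul hRS0
  have hS0 := right_ne_zero_of_mul hRS0
  rw [uniformMeasure, integral_smul_measure, hp', ENNReal.toReal_inv, Complex.real_smul]
  change (((S.real Set.univ)⁻¹ : ℝ) : ℂ) * _ = _
  rw [Complex.ofReal_inv, div_eq_mul_inv]
  generalize ∫ ψ : PureState (A × A), evalAt p ψ.1 ∂S = I
  rw [eq_mul_inv_iff_mul_eq₀ hQ0, eq_inv_mul_iff_mul_eq₀ h1]
  field_simp
  linear_combination (-I) * hRS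

end SphereAverages

/-! ### Entropy bounds for designs -/

section Entropy

open scoped ComplexOrder

variable {A : Type} [Fintype A] [DecidableEq A]

lemma catalan_pos (n : ℕ) : 0 < catalan n := by
  have h := succ_mul_catalan_eq_centralBinom n
  exact Nat.pos_of_mul_pos_left (h ▸ Nat.centralBinom_pos n)

lemma trace_pow_eq_sum_eigenvalues {ρ : Matrix A A ℂ} (hρ : ρ.IsHermitian) (k : ℕ) :
    (ρ ^ k).trace = ((∑ i, hρ.eigenvalues i ^ k : ℝ) : ℂ) := by
  conv_lhs => rw [hρ.spectral_theorem, ← map_pow, Matrix.diagonal_pow]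
  rw [Unitary.conjStarAlgAut_apply, Matrix.trace_mul_cycle, Unitary.coe_star_mul_self,
    Matrix.one_mul, Matrix.trace_diagonal]
  simp

lemma posSemidef_partialTraceB_pureDensity {A B : Type} [Fintype A] [Fintype B]
    (ψ : EuclideanSpace ℂ (A × B)) : (partialTraceB (pureDensity ψ)).PosSemidef := by
  have h : partialTraceB (pureDensity ψ) =
      (Matrix.of fun a b => ψ (a, b)) * (Matrix.of fun a b => ψ (a, b)).conjTranspose := by
    ext a b
    simp [partialTraceB, pureDensity, Matrix.mul_apply]
  rw [h]
  exact Matrix.posSemidef_self_mul_conjTranspose _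

/-- The trace of the `k`-th power of the reduced density matrix. -/
def purity (k : ℕ) (ψ : PureState (A × A)) : ℝ :=
  ((partialTraceB (pureDensity ψ.1) ^ k).trace).re

lemma ofReal_purity (k : ℕ) (ψ : PureState (A × A)) :
    (purity k ψ : ℂ) = evalAt (traceMoment A k) ψ.1 := by
  rw [evalAt_traceMoment, purity,
    trace_pow_eq_sum_eigenvalues (posSemidef_partialTraceB_pureDensity ψ.1).isHermitian,
    Complex.ofReal_re]

/-- Power mean inequality for the nonnegative eigenvalues, whose sum is `1`. -/
lemma inv_card_pow_le_purity (k : ℕ) (ψ : PureState (A × A)) :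
    ((Fintype.card A : ℝ) ^ k)⁻¹ ≤ purity (k + 1) ψ := by
  have hρ := posSemidef_partialTraceB_pureDensity ψ.1
  have h := pow_sum_div_card_le_sum_pow (s := Finset.univ) (f := hρ.isHermitian.eigenvalues)
    (fun i _ => hρ.eigenvalues_nonneg i) k
  have h1 : ∑ i, hρ.isHermitian.eigenvalues i = 1 := by
    have := trace_pow_eq_sum_eigenvalues hρ.isHermitian 1
    simp only [pow_one, trace_partialTraceB] at this
    exact_mod_cast this.symm
  rw [h1, one_pow, one_div, Finset.card_univ] at h
  rwa [purity, trace_pow_eq_sum_eigenvalues hρ.isHermitian, Complex.ofReal_re]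

lemma nonempty_of_pureState {A : Type} [Fintype A] (ψ : PureState (A × A)) : Nonempty A := by
  by_contra h
  rw [not_nonempty_iff] at h
  have := ψ.2
  simp [Subsingleton.elim ψ.1 0] at this

lemma purity_pos (k : ℕ) (ψ : PureState (A × A)) : 0 < purity (k + 1) ψ := by
  have := nonempty_of_pureState ψ
  refine lt_of_lt_of_le ?_ (inv_card_pow_le_purity k ψ)
  have := Fintype.card_pos (α := A)
  positivity

lemma continuous_purity (k : ℕ) : Continuous (purity (A := A) k) := by
  unfold purity partialTraceB pureDensity
  fun_prop

lemma entanglementEntropy_eq (k : ℕ) (ψ : PureState (A × A)) :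
    entanglementEntropy (k + 1) ψ = -(Real.logb 2 (purity (k + 1) ψ) / k) := by
  rw [entanglementEntropy, renyiEntropy, purity]
  push_cast
  rw [show (1 : ℝ) - (k + 1) = -k by ring]
  rw [one_div, inv_neg]
  ring

lemma entanglementEntropy_le {k : ℕ} (hk : 0 < k) (ψ : PureState (A × A)) :
    entanglementEntropy (k + 1) ψ ≤ Real.logb 2 (Fintype.card A) := by
  have := nonempty_of_pureState ψ
  have hd : (0 : ℝ) < Fintype.card A := by exact_mod_cast Fintype.card_pos
  have hk' : (0 : ℝ) < k := by exact_mod_cast hk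
  have h := Real.logb_le_logb_of_le one_lt_two (by positivity) (inv_card_pow_le_purity k ψ)
  rw [Real.logb_inv, Real.logb_pow] at h
  rw [entanglementEntropy_eq, neg_le, le_div_iff₀ hk']
  linarith

lemma continuous_logb_purity (k : ℕ) :
    Continuous fun ψ : PureState (A × A) => Real.logb 2 (purity (k + 1) ψ) :=
  (continuous_purity (k + 1)).logb fun ψ => (purity_pos k ψ).ne'

lemma integrable_of_continuous {A : Type} [Fintype A] {f : PureState (A × A) → ℝ} (hf : Continuous f)
    (ν : Measure (PureState (A × A))) [IsFiniteMeasure ν] : Integrable f ν := by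
  rw [← integrableOn_univ]
  exact hf.continuousOn.integrableOn_compact isCompact_univ

lemma integrable_entanglementEntropy (k : ℕ) (ν : Measure (PureState (A × A)))
    [IsFiniteMeasure ν] : Integrable (fun ψ => entanglementEntropy (k + 1) ψ) ν := by
  simp only [entanglementEntropy_eq]
  exact ((integrable_of_continuous (continuous_logb_purity k) ν).div_const _).neg

/-- Jensen's inequality via the tangent line of log at `M`; any positive upper bound `M` of the mean
will do. -/
lemma integral_logb_le {Ω : Type*} [MeasurableSpace Ω] (ν : Measure Ω) [IsProbabilityMeasure ν]
    {f : Ω → ℝ} (hpos : ∀ x, 0 < f x) (hf : Integrable f ν)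
    (hl : Integrable (fun x => Real.logb 2 (f x)) ν) {M : ℝ} (hM : ∫ x, f x ∂ν ≤ M) (hM0 : 0 < M) :
    ∫ x, Real.logb 2 (f x) ∂ν ≤ Real.logb 2 M := by
  have hlog : 0 < Real.log 2 := Real.log_pos one_lt_two
  have hpt (x : Ω) : Real.logb 2 (f x) ≤ Real.logb 2 M + (f x / M - 1) / Real.log 2 := by
    have h := Real.log_le_sub_one_of_pos (div_pos (hpos x) hM0)
    rw [Real.log_div (hpos x).ne' hM0.ne'] at h
    rw [Real.logb, Real.logb, ← add_div]
    gcongr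
    linarith
  have hg : Integrable (fun x => (f x / M - 1) / Real.log 2) ν :=
    ((hf.div_const M).sub (integrable_const 1)).div_const _
  refine (integral_mono hl ((integrable_const _).add hg) hpt).trans ?_
  have hI : ∫ x, (f x / M - 1) / Real.log 2 ∂ν ≤ 0 := by
    rw [integral_div, integral_sub (hf.div_const M) (integrable_const 1), integral_div]
    simp only [integral_const, probReal_univ, smul_eq_mul, mul_one]
    apply div_nonpos_of_nonpos_of_nonneg _ hlog.le
    rw [sub_nonpos]
    exact (div_le_one hM0).2 hM
  change ∫ x, (Real.logb 2 M + (f x / M - 1) / Real.log 2) ∂ν ≤ _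
  rw [integral_add (integrable_const _) hg]
  simp only [integral_const, probReal_univ, smul_eq_mul, one_mul]
  linarith

lemma integral_purity_design {k : ℕ} [Nonempty A] {ν : Measure (PureState (A × A))}
    (hν : IsProjectiveDesign k ν) :
    ((∫ ψ, purity k ψ ∂ν : ℝ) : ℂ) = gaussianMean (A × A) (traceMoment A k) /
      ((∏ j ∈ Finset.range k, (Fintype.card A ^ 2 + j) : ℕ) : ℂ) := by
  rw [← integral_uniformMeasure_of_isBihomogeneous (isBihomogeneous_traceMoment k),
    ← hν _ (isBihomogeneous_traceMoment k), ← integral_complex_ofReal]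
  simp only [ofReal_purity]

/-- The average purity of a design is at most its planar value, up to a relative error of order
`d⁻²`. -/
theorem exists_integral_purity_le (k : ℕ) : ∃ C : ℝ, 0 ≤ C ∧
    ∀ (A : Type) [Fintype A] [DecidableEq A] [Nonempty A] (ν : Measure (PureState (A × A))),
      IsProjectiveDesign (k + 1) ν →
      ∫ ψ, purity (k + 1) ψ ∂ν ≤ catalan (k + 1) * ((Fintype.card A : ℝ) ^ k)⁻¹ *
        (1 + C * ((Fintype.card A : ℝ) ^ 2)⁻¹) := by
  obtain ⟨C, hC, h⟩ := hasPlanarLimit [k + 1]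
  have hcat : 1 ≤ (catalan (k + 1) : ℝ) := by
    exact_mod_cast catalan_pos (k + 1)
  refine ⟨C, hC, fun A _ _ _ ν hν => ?_⟩
  have hb := h A _ (isGaussian_gaussianMean (A × A))
  have hd : (0 : ℝ) < Fintype.card A := by exact_mod_cast Fintype.card_pos
  set d := (Fintype.card A : ℝ) with hd'
  simp only [momentProd_cons, momentProd_nil, mul_one, catalanProd, List.map_cons, List.map_nil,
    List.prod_cons, List.prod_nil, momentDegree, List.sum_cons, List.sum_nil, add_zero,
    List.length_cons, List.length_nil, zero_add] at hb
  set z := gaussianMean (A × A) (traceMoment A (k + 1))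
  have hz : ‖z‖ ≤ catalan (k + 1) * d ^ (k + 1 + 1) * (1 + C * (d ^ 2)⁻¹) := by
    have h1 : ‖z - catalan (k + 1) * (Fintype.card A : ℂ) ^ (k + 1 + 1)‖ ≤
        C * d ^ (k + 1 + 1) * (d ^ 2)⁻¹ := by
      rw [← div_eq_mul_inv, le_div_iff₀ (by positivity), mul_comm]
      exact hb
    have h2 : ‖(catalan (k + 1) : ℂ) * (Fintype.card A : ℂ) ^ (k + 1 + 1)‖ =
        catalan (k + 1) * d ^ (k + 1 + 1) := by simp [hd']
    have h3 := norm_add_le (z - catalan (k + 1) * (Fintype.card A : ℂ) ^ (k + 1 + 1))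
      (catalan (k + 1) * (Fintype.card A : ℂ) ^ (k + 1 + 1))
    rw [sub_add_cancel, h2] at h3
    -- The Catalan number is at least `1`, so it can be factored out of the error too.
    have h4 : C * d ^ (k + 1 + 1) * (d ^ 2)⁻¹ ≤
        catalan (k + 1) * (C * d ^ (k + 1 + 1) * (d ^ 2)⁻¹) :=
      le_mul_of_one_le_left (by positivity) hcat
    linarith
  have hden : d ^ (2 * (k + 1)) ≤
      ((∏ j ∈ Finset.range (k + 1), (Fintype.card A ^ 2 + j) : ℕ) : ℝ) := by
    rw [pow_mul]
    push_cast
    calc (d ^ 2) ^ (k + 1) = ∏ _j ∈ Finset.range (k + 1), d ^ 2 := by simp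
      _ ≤ _ := Finset.prod_le_prod (fun _ _ => by positivity) fun j _ => by
        simp [hd']
  calc ∫ ψ, purity (k + 1) ψ ∂ν ≤ ‖((∫ ψ, purity (k + 1) ψ ∂ν : ℝ) : ℂ)‖ := by
        rw [Complex.norm_real]; exact le_abs_self _
    _ = ‖z‖ / ((∏ j ∈ Finset.range (k + 1), (Fintype.card A ^ 2 + j) : ℕ) : ℝ) := by
        rw [integral_purity_design hν, norm_div, Complex.norm_natCast]
    _ ≤ catalan (k + 1) * d ^ (k + 1 + 1) * (1 + C * (d ^ 2)⁻¹) / d ^ (2 * (k + 1)) := by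
        gcongr
    _ = _ := by
        field_simp
        ring

/-- The averaged entropy of a design is at least its planar value, up to an error of order
`d⁻²`. -/
theorem exists_le_integral_entanglementEntropy {k : ℕ} (hk : 0 < k) : ∃ C : ℝ, 0 ≤ C ∧
    ∀ (A : Type) [Fintype A] [DecidableEq A] [Nonempty A] (ν : Measure (PureState (A × A)))
      [IsProbabilityMeasure ν], IsProjectiveDesign (k + 1) ν →
      Real.logb 2 (Fintype.card A) - Real.logb 2 (catalan (k + 1)) / k -
        C * ((Fintype.card A : ℝ) ^ 2)⁻¹ ≤ ∫ ψ, entanglementEntropy (k + 1) ψ ∂ν := by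
  obtain ⟨C, hC, h⟩ := exists_integral_purity_le k
  have hlog : 0 < Real.log 2 := Real.log_pos one_lt_two
  have hk' : (0 : ℝ) < k := by exact_mod_cast hk
  have hcat : (0 : ℝ) < catalan (k + 1) := by
    exact_mod_cast catalan_pos (k + 1)
  refine ⟨C / Real.log 2 / k, by positivity, fun A _ _ _ ν _ hν => ?_⟩
  have hd : (0 : ℝ) < Fintype.card A := by exact_mod_cast Fintype.card_pos
  set d := (Fintype.card A : ℝ)
  have hJ := integral_logb_le ν (purity_pos (A := A) k)
    (integrable_of_continuous (continuous_purity (k + 1)) ν)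
    (integrable_of_continuous (continuous_logb_purity k) ν) (h A ν hν) (by positivity)
  rw [Real.logb_mul (by positivity) (by positivity), Real.logb_mul hcat.ne' (by positivity),
    Real.logb_inv, Real.logb_pow] at hJ
  have h1 : Real.logb 2 (1 + C * (d ^ 2)⁻¹) ≤ C / Real.log 2 * (d ^ 2)⁻¹ := by
    have := Real.log_le_sub_one_of_pos (x := 1 + C * (d ^ 2)⁻¹) (by positivity)
    rw [Real.logb, div_mul_eq_mul_div]
    gcongr
    linarith
  simp only [entanglementEntropy_eq]
  rw [integral_neg, integral_div, le_neg, div_le_iff₀ hk']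
  refine (hJ.trans (add_le_add_right h1 _)).trans (le_of_eq ?_)
  field_simp
  ring

/-- From `Cat_(k+1) ≤ 4 ^ (k + 1)` the quotient is at most `2 (k + 1) / k`, which is largest at `k =
1`. -/
lemma logb_catalan_le {k : ℕ} (hk : 0 < k) : Real.logb 2 (catalan (k + 1)) / k ≤ 4 := by
  have hk' : (1 : ℝ) ≤ k := by exact_mod_cast hk
  have h1 : catalan (k + 1) ≤ 4 ^ (k + 1) := by
    rw [catalan_eq_centralBinom_div]
    refine (Nat.div_le_self _ _).trans ?_
    rw [Nat.centralBinom, show 4 = 2 ^ 2 by norm_num, ← pow_mul]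
    exact Nat.choose_le_two_pow _ _
  have h2 : (catalan (k + 1) : ℝ) ≤ 2 ^ (2 * (k + 1)) := by
    rw [pow_mul]
    norm_num
    exact_mod_cast h1
  have hcat : (0 : ℝ) < catalan (k + 1) := by
    exact_mod_cast catalan_pos (k + 1)
  have h3 := Real.logb_le_logb_of_le one_lt_two hcat h2
  rw [Real.logb_pow, Real.logb_self_eq_one one_lt_two] at h3
  rw [div_le_iff₀ (by linarith)]
  push_cast at h3
  linarith

end Entropy

end QuantumDesign

end

theorem theorem1 :
    (∀ α : ℕ, 2 ≤ α →
      ∃ e : ℕ → ℝ, e =O[atTop] (fun d : ℕ => ((d : ℝ) ^ 2)⁻¹) ∧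
        ∀ (d : ℕ) (ν : Measure (QuantumDesign.PureState (Fin d × Fin d))),
          IsProbabilityMeasure ν → QuantumDesign.IsProjectiveDesign α ν →
            Integrable (fun ψ => QuantumDesign.entanglementEntropy α ψ) ν ∧
            Real.logb 2 d - Real.logb 2 (catalan α) / ((α : ℝ) - 1) + e d ≤
              ∫ ψ, QuantumDesign.entanglementEntropy α ψ ∂ν ∧
            ∫ ψ, QuantumDesign.entanglementEntropy α ψ ∂ν ≤ Real.logb 2 d) ∧
    (∃ K : ℝ, ∀ α : ℕ, 2 ≤ α → ∀ᶠ d : ℕ in atTop,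
      ∀ ν : Measure (QuantumDesign.PureState (Fin d × Fin d)),
        IsProbabilityMeasure ν → QuantumDesign.IsProjectiveDesign α ν →
          Real.logb 2 d - K ≤ ∫ ψ, QuantumDesign.entanglementEntropy α ψ ∂ν) := by
  have hα (α : ℕ) (h : 2 ≤ α) : ∃ k, 0 < k ∧ α = k + 1 := ⟨α - 1, by omega, by omega⟩
  constructor
  · intro α h
    obtain ⟨k, hk, rfl⟩ := hα α h
    obtain ⟨C, -, hC⟩ := QuantumDesign.exists_le_integral_entanglementEntropy hk
    refine ⟨fun d => -C * ((d : ℝ) ^ 2)⁻¹, (isBigO_refl _ _).const_mul_left _,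
      fun d ν _ hν => ?_⟩
    -- For `d = 0` the sphere is empty and carries no probability measure, so that case is vacuous.
    obtain ⟨ψ⟩ := nonempty_of_isProbabilityMeasure ν
    have := QuantumDesign.nonempty_of_pureState ψ
    have hI := QuantumDesign.integrable_entanglementEntropy k ν
    refine ⟨hI, ?_, ?_⟩
    · have := hC (Fin d) ν hν
      rw [Fintype.card_fin] at this
      push_cast
      rw [add_sub_cancel_right]
      linarith
    · have := integral_mono hI (integrable_const _)
        (QuantumDesign.entanglementEntropy_le (A := Fin d) hk)
      simpa using this
  -- Here `5 = 4 + 1`: `4` bounds the Catalan term and `1` eventually bounds the error.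
  · refine ⟨5, fun α h => ?_⟩
    obtain ⟨k, hk, rfl⟩ := hα α h
    obtain ⟨C, -, hC⟩ := QuantumDesign.exists_le_integral_entanglementEntropy hk
    have hlim : Tendsto (fun d : ℕ => C * ((d : ℝ) ^ 2)⁻¹) atTop (nhds 0) := by
      have h1 : Tendsto (fun d : ℕ => ((d : ℝ) ^ 2)⁻¹) atTop (nhds 0) :=
        ((tendsto_pow_atTop two_ne_zero).comp tendsto_natCast_atTop_atTop).inv_tendsto_atTop
      simpa using h1.const_mul C
    filter_upwards [hlim.eventually (gt_mem_nhds one_pos)] with d hd ν _ hν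
    obtain ⟨ψ⟩ := nonempty_of_isProbabilityMeasure ν
    have := QuantumDesign.nonempty_of_pureState ψ
    have h2 := hC (Fin d) ν hν
    have h3 := QuantumDesign.logb_catalan_le hk
    rw [Fintype.card_fin] at h2
    linarith
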